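/- Let $\rho(x)=\dfrac{e^{-x^2/2}}{\sqrt{2\pi}}$ on $\mathbb{R}$, and let $L^2(\rho)$ be the space of real-valued functions that are square integrable with respect to $\rho(x)\,dx$. Let $(\tilde P_n)_{n\ge 0}$ be the orthonormal polynomials of $\rho$, that is, $\tilde P_n=P_n/\|P_n\|_{L^2(\rho)}$, where the monic polynomials $P_n$ of degree $n$ are obtained from the monomials $1,x,x^2,\dots$ by Gram–Schmidt orthogonalization in $L^2(\rho)$. For $N\in\mathbb{N}$ put $V_N=\operatorname{Span}\{\tilde P_0,\dots,\tilde P_N\}$, and for $f\in L^2(\rho)$ let $$\pi_{V_N}f=\sum_{n=0}^{N}\Big(\int_{\mathbb{R}} f\,\tilde P_n\,\rho\,dy\Big)\tilde P_n\in L^2(\rho)$$ be the orthogonal projection of $f$ on $V_N$. For $k\in\mathbb{N}$ let $H^k(\rho)$ be the space of functions $f\in L^2(\rho)$ whose distributional derivatives $f^{(i)}$, $0\le i\le k$, are functions in $L^2(\rho)$, with the norm $\|f\|_{H^k(\rho)}=\big(\sum_{i=0}^{k}\|f^{(i)}\|_{L^2(\rho)}^2\big)^{1/2}$. Then for every integer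 $k\ge 1$ there is a constant $\Lambda_k>0$, depending only on $k$, such that for all $f\in H^k(\rho)$ and all integers $N\ge 1$ one has $f-\pi_{V_N}f\in L^2(\rho)$ and $$\|f-\pi_{V_N}f\|_{L^2(\rho)}\le \Lambda_k\,\|f\|_{H^k(\rho)}\,\frac{1}{N^{k/2}}.$$ -/

import Mathlib

open MeasureTheory

namespace WeightedApprox

/-- The Gaussian weight `ρ(x) = exp(-x²/2) / √(2π)`. -/
noncomputable def rho (x : ℝ) : ℝ := Real.exp (-x ^ 2 / 2) / Real.sqrt (2 * Real.pi)

/-- The measure `ρ(x) dx` on the real line. -/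
noncomputable def rhoMeasure : Measure ℝ := volume.withDensity fun x => ENNReal.ofReal (rho x)

/-- The measure `ρ(x) dx` is the standard Gaussian measure. -/
theorem rhoMeasure_eq_gaussianReal : rhoMeasure = ProbabilityTheory.gaussianReal 0 1 := by
  rw [ProbabilityTheory.gaussianReal_of_var_ne_zero 0 one_ne_zero, rhoMeasure]
  congr 1
  funext x
  simp [rho, ProbabilityTheory.gaussianPDF, ProbabilityTheory.gaussianPDFReal, div_eq_inv_mul]

/-- The norm of `L²(μ)`, meaningful for functions `f` with `MemLp f 2 μ`. -/
noncomputable def l2Norm (μ : Measure ℝ) (f : ℝ → ℝ) : ℝ := (eLpNorm f 2 μ).toReal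

/-- The monic orthogonal polynomials `P_n` of the measure `μ`, obtained by applying the
Gram-Schmidt orthogonalization process to the monomials:
`P_n = X^n - ∑_{j < n} (⟨x^n, P_j⟩ / ⟨P_j, P_j⟩) P_j` in `L²(μ)`. -/
noncomputable def monicPoly (μ : Measure ℝ) (n : ℕ) : Polynomial ℝ :=
  Polynomial.X ^ n - ∑ j : Fin n,
    Polynomial.C ((∫ x, x ^ n * (monicPoly μ j.1).eval x ∂μ) /
      (∫ x, (monicPoly μ j.1).eval x ^ 2 ∂μ)) * monicPoly μ j.1
termination_by n
decreasing_by all_goals exact j.2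

/-- The orthonormal polynomials `P_n / ‖P_n‖` of the measure `μ`, as polynomial functions. -/
noncomputable def orthonormalPoly (μ : Measure ℝ) (n : ℕ) (x : ℝ) : ℝ :=
  (monicPoly μ n).eval x / l2Norm μ fun y => (monicPoly μ n).eval y

/-- The orthogonal projection of `f ∈ L²(μ)` on the span of the orthonormal polynomials of
index `0, …, N`. -/
noncomputable def proj (μ : Measure ℝ) (N : ℕ) (f : ℝ → ℝ) (x : ℝ) : ℝ :=
  ∑ n ∈ Finset.range (N + 1), (∫ y, f y * orthonormalPoly μ n y ∂μ) * orthonormalPoly μ n x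

/-- `g` is the `i`-th derivative of `f` in the sense of distributions on the real line
(with respect to Lebesgue measure), `f` and `g` being locally integrable functions. -/
def HasWeakDeriv (i : ℕ) (f g : ℝ → ℝ) : Prop :=
  LocallyIntegrable f ∧ LocallyIntegrable g ∧
    ∀ η : ℝ → ℝ, ContDiff ℝ (⊤ : ℕ∞) η → HasCompactSupport η →
      ∫ x, f x * iteratedDeriv i η x = (-1) ^ i * ∫ x, g x * η x

/-- The `i`-th weak derivative `f^(i)`, a function determined up to equality almost everywhere
(and `0` by convention if `f` has none). -/
noncomputable def weakDeriv (i : ℕ) (f : ℝ → ℝ) : ℝ → ℝ :=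
  open Classical in if h : ∃ g, HasWeakDeriv i f g then h.choose else 0

/-- `f` belongs to the weighted Sobolev space `H^k(μ)`: it lies in `L²(μ)` and its distributional
derivatives of order `i ≤ k` are functions in `L²(μ)`. -/
def MemSobolev (μ : Measure ℝ) (k : ℕ) (f : ℝ → ℝ) : Prop :=
  MemLp f 2 μ ∧ ∀ i ≤ k, ∃ g, HasWeakDeriv i f g ∧ MemLp g 2 μ

/-- The norm of `H^k(μ)`: `‖f‖² = ∑_{i ≤ k} ‖f^(i)‖²`, the norms on the right being those of
`L²(μ)`. -/
noncomputable def sobolevNorm (μ : Measure ℝ) (k : ℕ) (f : ℝ → ℝ) : ℝ :=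
  Real.sqrt (∑ i ∈ Finset.range (k + 1), l2Norm μ (weakDeriv i f) ^ 2)

end WeightedApprox

/-!
The Gram-Schmidt polynomials of the Gaussian weight are the Hermite polynomials `He_n`
(`monicPoly_rhoMeasure`). Integration by parts against `ρ` gives `⟨He_n, q⟩ = ∫ q^(n) ρ` for every
polynomial `q`, hence orthogonality and `‖He_n‖² = n!`.

The operator `p ↦ x p - p'`, which maps `He_n` to `He_{n+1}`, is the adjoint of the derivative in
`L²(ρ)`. Tested against a truncation of `ρ He_n`, the definition of the weak derivative therefore
gives `⟨f^(k), He_n⟩ = ⟨f, He_{n+k}⟩` (`MemSobolev.integral_mul_hermiteReal`).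

The Hermite polynomials are complete: if `f ∈ L²(ρ)` is orthogonal to all of them, the Fourier
transform of `f ρ` has a vanishing power series, so `f = 0`
(`ae_eq_zero_of_integral_mul_pow_eq_zero`). Parseval's identity
(`hasSum_integral_mul_hermiteReal_sq`) then expresses the squared error as
`∑_{n > N} ⟨f, He_n⟩² / n!`. For `n ≥ k` the summand is `(n - k)! / n!` times the squared
normalized coefficient of order `n - k` of `f^(k)`, and
`n! / (n - k)! ≥ (n + 1 - k)^k ≥ (n / k)^k`. This gives the bound with `Λ_k = k^(k/2)`; the terms
with `N < n < k` need no decay, because then `k^k / N^k ≥ 1` (`l2Norm_sub_proj_sq_le`).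
-/

open MeasureTheory

namespace WeightedApprox

open Polynomial ProbabilityTheory Filter Topology

/-! ### Hermite polynomials and the Gaussian measure -/

/-- The probabilists' Hermite polynomial `He_n`, with real coefficients. -/
noncomputable def hermiteReal (n : ℕ) : ℝ[X] := (hermite n).map (Int.castRingHom ℝ)

lemma hermiteReal_succ (n : ℕ) :
    hermiteReal (n + 1) = X * hermiteReal n - derivative (hermiteReal n) := by
  simp [hermiteReal, hermite_succ, derivative_map]

lemma coeff_hermiteReal_self (n : ℕ) : (hermiteReal n).coeff n = 1 := by
  simp [hermiteReal, coeff_hermite_self]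

lemma coeff_hermiteReal_of_lt {n k : ℕ} (h : n < k) : (hermiteReal n).coeff k = 0 := by
  simp [hermiteReal, coeff_hermite_of_lt h]

lemma natDegree_hermiteReal_le (n : ℕ) : (hermiteReal n).natDegree ≤ n :=
  natDegree_le_iff_coeff_eq_zero.2 fun _ h => coeff_hermiteReal_of_lt h

instance : IsProbabilityMeasure rhoMeasure := by
  rw [rhoMeasure_eq_gaussianReal]; infer_instance

lemma rho_pos (x : ℝ) : 0 < rho x := by unfold rho; positivity

lemma contDiff_rho : ContDiff ℝ (⊤ : ℕ∞) rho := by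
  unfold rho; fun_prop

lemma hasDerivAt_rho (x : ℝ) : HasDerivAt rho (-x * rho x) x := by
  have h : HasDerivAt (fun y : ℝ => -y ^ 2 / 2) (-x) x := by
    convert! ((hasDerivAt_pow 2 x).neg).div_const 2 using 1
    simp; ring
  convert! h.exp.div_const (Real.sqrt (2 * Real.pi)) using 1
  unfold rho; ring

lemma measurable_rho : Measurable rho := contDiff_rho.continuous.measurable

lemma integral_rhoMeasure (f : ℝ → ℝ) : ∫ x, f x ∂rhoMeasure = ∫ x, rho x * f x := by
  rw [rhoMeasure, integral_withDensity_eq_integral_toReal_smul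
    measurable_rho.ennreal_ofReal (by simp)]
  simp [ENNReal.toReal_ofReal (rho_pos _).le]

lemma integrable_rhoMeasure_iff {f : ℝ → ℝ} :
    Integrable f rhoMeasure ↔ Integrable fun x => rho x * f x := by
  rw [rhoMeasure, integrable_withDensity_iff_integrable_smul'
    measurable_rho.ennreal_ofReal (by simp)]
  simp [ENNReal.toReal_ofReal (rho_pos _).le]

lemma integrable_eval (p : ℝ[X]) : Integrable (fun x => p.eval x) rhoMeasure := by
  induction p using Polynomial.induction_on' with
  | add p q hp hq =>
    simp only [eval_add]
    exact hp.add hq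
  | monomial n a =>
    simp only [eval_monomial]
    refine Integrable.const_mul ?_ a
    have h : MemLp (id : ℝ → ℝ) n rhoMeasure := by
      rw [rhoMeasure_eq_gaussianReal]
      exact_mod_cast memLp_id_gaussianReal (n : NNReal)
    refine (integrable_norm_iff (by fun_prop)).1 ?_
    simpa using h.integrable_norm_pow'

lemma memLp_eval (p : ℝ[X]) : MemLp (fun x => p.eval x) 2 rhoMeasure := by
  refine (memLp_two_iff_integrable_sq p.continuous.aestronglyMeasurable).2 ?_
  exact (integrable_eval (p ^ 2)).congr (Filter.Eventually.of_forall fun x => eval_pow 2)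

lemma integrable_eval_mul_eval (p q : ℝ[X]) :
    Integrable (fun x => p.eval x * q.eval x) rhoMeasure := by
  simpa using integrable_eval (p * q)

/-! ### Orthogonality of the Hermite polynomials -/

/-- Gaussian integration by parts for a polynomial: the integrand, multiplied by the weight, is
the derivative of `-ρ u`. -/
lemma integral_X_mul_sub_derivative (u : ℝ[X]) :
    ∫ x, (X * u - derivative u).eval x ∂rhoMeasure = 0 := by
  rw [integral_rhoMeasure]
  refine integral_eq_zero_of_hasDerivAt_of_integrable (f := fun x => - (rho x * u.eval x))
    (fun x => ?_) (integrable_rhoMeasure_iff.1 (integrable_eval _))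
    (integrable_rhoMeasure_iff.1 (integrable_eval _)).neg
  convert! ((hasDerivAt_rho x).mul (u.hasDerivAt x)).neg using 1
  simp; ring

lemma integral_hermiteReal_succ_mul (n : ℕ) (q : ℝ[X]) :
    ∫ x, (hermiteReal (n + 1)).eval x * q.eval x ∂rhoMeasure =
      ∫ x, (hermiteReal n).eval x * (derivative q).eval x ∂rhoMeasure := by
  rw [← sub_eq_zero, ← integral_sub (integrable_eval_mul_eval _ _) (integrable_eval_mul_eval _ _),
    ← integral_X_mul_sub_derivative (hermiteReal n * q)]
  congr with x
  simp [hermiteReal_succ]; ring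

/-- Moving all `n` derivatives onto `q`: orthogonality to lower degrees and the value `n!` of the
squared norm both follow from this. -/
lemma integral_hermiteReal_mul (n : ℕ) (q : ℝ[X]) :
    ∫ x, (hermiteReal n).eval x * q.eval x ∂rhoMeasure =
      ∫ x, (derivative^[n] q).eval x ∂rhoMeasure := by
  induction n generalizing q with
  | zero => simp [hermiteReal]
  | succ n ih => rw [integral_hermiteReal_succ_mul, ih, Function.iterate_succ_apply]

lemma integral_hermiteReal_mul_of_degree_lt {n : ℕ} {q : ℝ[X]} (h : q.natDegree < n) :
    ∫ x, (hermiteReal n).eval x * q.eval x ∂rhoMeasure = 0 := by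
  rw [integral_hermiteReal_mul, iterate_derivative_eq_zero h]
  simp

lemma integral_hermiteReal_mul_hermiteReal (m n : ℕ) :
    ∫ x, (hermiteReal m).eval x * (hermiteReal n).eval x ∂rhoMeasure =
      if m = n then (n.factorial : ℝ) else 0 := by
  rcases lt_trichotomy m n with h | rfl | h
  · rw [if_neg h.ne]
    simp_rw [mul_comm ((hermiteReal m).eval _)]
    exact integral_hermiteReal_mul_of_degree_lt ((natDegree_hermiteReal_le m).trans_lt h)
  · rw [integral_hermiteReal_mul]
    have h0 : (derivative^[m] (hermiteReal m)).natDegree ≤ 0 := by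
      have := natDegree_iterate_derivative (hermiteReal m) m
      have := natDegree_hermiteReal_le m
      omega
    rw [eq_C_of_natDegree_le_zero h0, coeff_iterate_derivative]
    simp [coeff_hermiteReal_self, Nat.descFactorial_self]
  · rw [if_neg h.ne']
    exact integral_hermiteReal_mul_of_degree_lt ((natDegree_hermiteReal_le n).trans_lt h)

/-- Hermite expansion of a polynomial of degree less than `n`. -/
lemma eq_sum_hermiteReal (n : ℕ) (p : ℝ[X]) (hp : ∀ m, n ≤ m → p.coeff m = 0) :
    p = ∑ j ∈ Finset.range n,
      C ((∫ x, p.eval x * (hermiteReal j).eval x ∂rhoMeasure) / j.factorial) * hermiteReal j := by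
  induction n generalizing p with
  | zero => ext m; simp [hp m]
  | succ n ih =>
    set a := p.coeff n
    set q := p - C a * hermiteReal n with hq
    have hqc : ∀ m, n ≤ m → q.coeff m = 0 := by
      intro m hm
      rcases hm.eq_or_lt with rfl | hm
      · simp [hq, coeff_hermiteReal_self, a]
      · simp [hq, coeff_hermiteReal_of_lt hm, hp m hm]
    have hpq : p = q + C a * hermiteReal n := by simp [hq]
    have hint (j : ℕ) : ∫ x, p.eval x * (hermiteReal j).eval x ∂rhoMeasure =
        (∫ x, q.eval x * (hermiteReal j).eval x ∂rhoMeasure) +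
          a * if n = j then (j.factorial : ℝ) else 0 := by
      rw [← integral_hermiteReal_mul_hermiteReal, ← integral_const_mul,
        ← integral_add (integrable_eval_mul_eval _ _)
          ((integrable_eval_mul_eval _ _).const_mul a)]
      congr with x
      rw [hpq]; simp; ring
    have hqn : ∫ x, q.eval x * (hermiteReal n).eval x ∂rhoMeasure = 0 := by
      rcases n.eq_zero_or_pos with rfl | hn
      · have : q = 0 := by ext m; simp [hqc m]
        simp [this]
      · simp_rw [mul_comm (q.eval _)]
        refine integral_hermiteReal_mul_of_degree_lt ?_
        have : q.natDegree ≤ n - 1 :=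
          natDegree_le_iff_coeff_eq_zero.2 fun m hm => hqc m (by omega)
        omega
    rw [Finset.sum_range_succ, hint n, hqn]
    have hn : (n.factorial : ℝ) ≠ 0 := by positivity
    simp only [if_true, zero_add, mul_div_cancel_right₀ a hn]
    conv_lhs => rw [hpq, ih q hqc]
    congr 1
    refine Finset.sum_congr rfl fun j hj => ?_
    rw [hint j, if_neg (Finset.mem_range.1 hj).ne', mul_zero, add_zero]

/-- Gram-Schmidt for the Gaussian weight produces the Hermite polynomials. -/
lemma monicPoly_rhoMeasure (n : ℕ) : monicPoly rhoMeasure n = hermiteReal n := by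
  induction n using Nat.strong_induction_on with
  | _ n ih =>
    have h := eq_sum_hermiteReal n (X ^ n - hermiteReal n) (by
      intro m hm
      rcases hm.eq_or_lt with rfl | hm
      · simp [coeff_hermiteReal_self]
      · simp [coeff_X_pow, hm.ne', coeff_hermiteReal_of_lt hm])
    rw [monicPoly, sub_eq_iff_eq_add, add_comm, ← sub_eq_iff_eq_add, h, Finset.sum_range]
    refine Finset.sum_congr rfl fun j _ => ?_
    rw [ih j j.2]
    have hnum : ∫ x, (X ^ n - hermiteReal n).eval x * (hermiteReal j).eval x ∂rhoMeasure =
        ∫ x, x ^ n * (hermiteReal j).eval x ∂rhoMeasure := by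
      have h0 := integral_hermiteReal_mul_hermiteReal n j
      rw [if_neg j.2.ne'] at h0
      rw [← sub_zero (∫ x, x ^ n * (hermiteReal j).eval x ∂rhoMeasure), ← h0, ← integral_sub
        (by simpa using integrable_eval_mul_eval (X ^ n) (hermiteReal j))
        (integrable_eval_mul_eval _ _)]
      congr with x
      simp; ring
    have hden := integral_hermiteReal_mul_hermiteReal j j
    rw [if_pos rfl] at hden
    simp_rw [pow_two, hden, hnum]

lemma l2Norm_sq {μ : Measure ℝ} {f : ℝ → ℝ} (hf : MemLp f 2 μ) :
    l2Norm μ f ^ 2 = ∫ x, f x * f x ∂μ := by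
  rw [l2Norm, ← Lp.norm_toLp f hf, ← real_inner_self_eq_norm_sq, L2.inner_def]
  refine integral_congr_ae ?_
  filter_upwards [hf.coeFn_toLp] with x hx
  simp [hx, pow_two]

lemma orthonormalPoly_rhoMeasure (n : ℕ) (x : ℝ) :
    orthonormalPoly rhoMeasure n x = (hermiteReal n).eval x / Real.sqrt n.factorial := by
  have h := l2Norm_sq (memLp_eval (hermiteReal n))
  rw [integral_hermiteReal_mul_hermiteReal, if_pos rfl] at h
  rw [orthonormalPoly, monicPoly_rhoMeasure, ← h, Real.sqrt_sq (by exact ENNReal.toReal_nonneg)]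

/-! ### Weak derivatives and Hermite coefficients -/

/-- A weak derivative of order `i + 1` is the first weak derivative of one of order `i`. -/
lemma HasWeakDeriv.succ {i : ℕ} {f g h : ℝ → ℝ} (hg : HasWeakDeriv i f g)
    (hh : HasWeakDeriv (i + 1) f h) : HasWeakDeriv 1 g h := by
  refine ⟨hg.2.1, hh.2.1, fun η hη hc => ?_⟩
  have hη' : ContDiff ℝ (⊤ : ℕ∞) (deriv η) := (contDiff_infty_iff_deriv.1 hη).2
  have h1 := hg.2.2 (deriv η) hη' hc.deriv
  have h2 := hh.2.2 η hη hc
  rw [iteratedDeriv_succ'] at h2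
  rw [h2, pow_succ, mul_assoc] at h1
  have h3 := mul_left_cancel₀ (pow_ne_zero i (by norm_num : (-1 : ℝ) ≠ 0)) h1
  rw [iteratedDeriv_one, ← h3, pow_one]

lemma HasWeakDeriv.ae_eq {i : ℕ} {f g h : ℝ → ℝ} (hg : HasWeakDeriv i f g)
    (hh : HasWeakDeriv i f h) : g =ᵐ[volume] h := by
  refine ae_eq_of_integral_contDiff_smul_eq hg.2.1 hh.2.1 fun η hη hc => ?_
  have h1 := (hg.2.2 η hη hc).symm.trans (hh.2.2 η hη hc)
  simpa [mul_comm] using mul_left_cancel₀ (pow_ne_zero i (by norm_num : (-1 : ℝ) ≠ 0)) h1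

lemma HasWeakDeriv.ae_eq_self {f g : ℝ → ℝ} (hg : HasWeakDeriv 0 f g) : g =ᵐ[volume] f :=
  hg.ae_eq ⟨hg.1, hg.1, fun η _ _ => by simp⟩

lemma rhoMeasure_absolutelyContinuous : rhoMeasure ≪ volume := withDensity_absolutelyContinuous _ _

lemma integrable_mul_eval {f : ℝ → ℝ} (hf : MemLp f 2 rhoMeasure) (p : ℝ[X]) :
    Integrable (fun x => f x * p.eval x) rhoMeasure := hf.integrable_mul (memLp_eval p)

lemma integrable_mul_rho_mul_eval {f : ℝ → ℝ} (hf : MemLp f 2 rhoMeasure) (p : ℝ[X]) :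
    Integrable (fun x => f x * (rho x * p.eval x)) :=
  (integrable_rhoMeasure_iff.1 (integrable_mul_eval hf p)).congr
    (Eventually.of_forall fun _ => mul_left_comm _ _ _)

lemma integral_mul_rho_mul_eval (f : ℝ → ℝ) (p : ℝ[X]) :
    ∫ x, f x * (rho x * p.eval x) = ∫ x, f x * p.eval x ∂rhoMeasure := by
  rw [integral_rhoMeasure]
  simp_rw [mul_left_comm]

/-- The adjoint of the weak derivative in `L²(ρ)` acts on polynomials as `p ↦ x p - p'`. The test
functions `χ(x / (m + 1)) ρ(x) p(x)`, with `χ` a bump function, exhaust `ρ p` as `m → ∞`. -/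
lemma HasWeakDeriv.integral_mul_eval {f g : ℝ → ℝ} (h : HasWeakDeriv 1 f g)
    (hf : MemLp f 2 rhoMeasure) (hg : MemLp g 2 rhoMeasure) (p : ℝ[X]) :
    ∫ x, g x * p.eval x ∂rhoMeasure = ∫ x, f x * (X * p - derivative p).eval x ∂rhoMeasure := by
  let χ : ContDiffBump (0 : ℝ) := default
  have hχ : ContDiff ℝ (⊤ : ℕ∞) χ := χ.contDiff
  have hχd : ∀ x, HasDerivAt χ (deriv χ x) x := fun x =>
    (hχ.differentiable (by simp) x).hasDerivAt
  have hχc : Continuous (deriv χ) := hχ.continuous_deriv (by simp)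
  obtain ⟨C, hC⟩ := χ.hasCompactSupport.deriv.exists_bound_of_continuous hχc
  let ε : ℕ → ℝ := fun m => 1 / ((m : ℝ) + 1)
  have hε0 : ∀ m, 0 < ε m := fun m => by positivity
  have hε1 : ∀ m, ε m ≤ 1 := fun m => by
    rw [div_le_one (by positivity)]; linarith [m.cast_nonneg (α := ℝ)]
  have hε : Tendsto ε atTop (𝓝 0) := tendsto_one_div_add_atTop_nhds_zero_nat
  have hεx : ∀ x, Tendsto (fun m => ε m * x) atTop (𝓝 0) := fun x => by
    simpa using hε.mul_const x
  have hχ1 : ∀ x, Tendsto (fun m => χ (ε m * x)) atTop (𝓝 1) := fun x => by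
    have := (χ.continuous.tendsto 0).comp (hεx x)
    rwa [χ.one_of_mem_closedBall (by simp [χ.rIn_pos.le])] at this
  have hχ0 : ∀ x, Tendsto (fun m => ε m * deriv χ (ε m * x)) atTop (𝓝 0) := fun x => by
    simpa using hε.mul ((hχc.tendsto 0).comp (hεx x))
  let η : ℕ → ℝ → ℝ := fun m x => χ (ε m * x) * (rho x * p.eval x)
  have hη : ∀ m, ContDiff ℝ (⊤ : ℕ∞) (η m) := fun m =>
    (hχ.comp (contDiff_const.mul contDiff_id)).mul (contDiff_rho.mul (by simpa using p.contDiff_aeval (R := ℝ) (𝕜 := ℝ) _))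
  have hηc : ∀ m, HasCompactSupport (η m) := fun m =>
    (χ.hasCompactSupport.comp_smul (hε0 m).ne').mul_right
  set q := derivative p - X * p with hq
  have hη' : ∀ m x, iteratedDeriv 1 (η m) x =
      ε m * deriv χ (ε m * x) * (rho x * p.eval x) + χ (ε m * x) * (rho x * q.eval x) := by
    intro m x
    rw [iteratedDeriv_one]
    have h1 : HasDerivAt (fun y => χ (ε m * y)) (deriv χ (ε m * x) * ε m) x :=
      (hχd _).comp x (by simpa using (hasDerivAt_id x).const_mul (ε m))
    convert! (h1.mul ((hasDerivAt_rho x).mul (p.hasDerivAt x))).deriv using 1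
    simp [hq]; ring
  have hfm := h.1.aestronglyMeasurable
  have hgm := h.2.1.aestronglyMeasurable
  -- The term carrying `χ'` is dominated by `C |f ρ p|` and tends to `0` pointwise.
  have lim1 : Tendsto (fun m => ∫ x, f x * iteratedDeriv 1 (η m) x) atTop
      (𝓝 (∫ x, f x * (rho x * q.eval x))) := by
    refine tendsto_integral_of_dominated_convergence
      (fun x => C * ‖f x * (rho x * p.eval x)‖ + ‖f x * (rho x * q.eval x)‖)
      (fun m => hfm.mul ?_)
      (((integrable_mul_rho_mul_eval hf p).norm.const_mul C).add
        (integrable_mul_rho_mul_eval hf q).norm)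
      (fun m => Eventually.of_forall fun x => ?_) (Eventually.of_forall fun x => ?_)
    · exact ((hη m).continuous_iteratedDeriv 1 (by simp)).aestronglyMeasurable
    · have h1 : ‖ε m * deriv χ (ε m * x)‖ ≤ C := by
        rw [norm_mul, Real.norm_of_nonneg (hε0 m).le]
        exact (mul_le_of_le_one_left (norm_nonneg _) (hε1 m)).trans (hC _)
      have h2 : ‖χ (ε m * x)‖ ≤ 1 := by
        rw [Real.norm_of_nonneg χ.nonneg]; exact χ.le_one
      have h3 : f x * iteratedDeriv 1 (η m) x =
          ε m * deriv χ (ε m * x) * (f x * (rho x * p.eval x)) +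
            χ (ε m * x) * (f x * (rho x * q.eval x)) := by rw [hη']; ring
      rw [h3]
      refine (norm_add_le _ _).trans ?_
      rw [norm_mul, norm_mul (χ _)]
      exact add_le_add (mul_le_mul_of_nonneg_right h1 (norm_nonneg _))
        (mul_le_of_le_one_left (norm_nonneg _) h2)
    · simp_rw [hη']
      simpa using (((hχ0 x).mul_const (rho x * p.eval x)).add
        ((hχ1 x).mul_const (rho x * q.eval x))).const_mul (f x)
  have lim2 : Tendsto (fun m => ∫ x, g x * η m x) atTop
      (𝓝 (∫ x, g x * (rho x * p.eval x))) := by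
    refine tendsto_integral_of_dominated_convergence (fun x => ‖g x * (rho x * p.eval x)‖)
      (fun m => hgm.mul (hη m).continuous.aestronglyMeasurable)
      (integrable_mul_rho_mul_eval hg p).norm
      (fun m => Eventually.of_forall fun x => ?_) (Eventually.of_forall fun x => ?_)
    · have h2 : ‖χ (ε m * x)‖ ≤ 1 := by
        rw [Real.norm_of_nonneg χ.nonneg]; exact χ.le_one
      rw [show g x * η m x = χ (ε m * x) * (g x * (rho x * p.eval x)) by simp only [η]; ring,
        norm_mul]
      exact mul_le_of_le_one_left (norm_nonneg _) h2
    · simpa using ((hχ1 x).mul_const (rho x * p.eval x)).const_mul (g x)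
  -- By the definition of the weak derivative the two sequences of integrals are opposite.
  have key := tendsto_nhds_unique lim1 ((lim2.neg).congr fun m => by
    rw [h.2.2 (η m) (hη m) (hηc m)]; ring)
  rw [integral_mul_rho_mul_eval, integral_mul_rho_mul_eval] at key
  rw [← neg_inj, ← key, ← integral_neg]
  congr with x
  simp [hq]; ring

lemma HasWeakDeriv.integral_mul_hermiteReal {f g : ℝ → ℝ} (h : HasWeakDeriv 1 f g)
    (hf : MemLp f 2 rhoMeasure) (hg : MemLp g 2 rhoMeasure) (n : ℕ) :
    ∫ x, g x * (hermiteReal n).eval x ∂rhoMeasure =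
      ∫ x, f x * (hermiteReal (n + 1)).eval x ∂rhoMeasure := by
  rw [h.integral_mul_eval hf hg, hermiteReal_succ]

/-- The Hermite coefficients of the `k`-th weak derivative are those of `f`, shifted by `k`. -/
lemma MemSobolev.integral_mul_hermiteReal {k : ℕ} {f g : ℝ → ℝ}
    (hf : MemSobolev rhoMeasure k f) (hg : HasWeakDeriv k f g) (n : ℕ) :
    ∫ x, g x * (hermiteReal n).eval x ∂rhoMeasure =
      ∫ x, f x * (hermiteReal (n + k)).eval x ∂rhoMeasure := by
  induction k generalizing g n with
  | zero =>
    refine integral_congr_ae ?_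
    filter_upwards [rhoMeasure_absolutelyContinuous.ae_le hg.ae_eq_self] with x hx
    rw [hx, add_zero]
  | succ k ih =>
    obtain ⟨u, hu, hu2⟩ := hf.2 k k.le_succ
    obtain ⟨v, hv, hv2⟩ := hf.2 (k + 1) le_rfl
    have hg2 : MemLp g 2 rhoMeasure :=
      hv2.ae_eq (rhoMeasure_absolutelyContinuous.ae_le (hv.ae_eq hg))
    rw [(hu.succ hg).integral_mul_hermiteReal hu2 hg2,
      ih ⟨hf.1, fun i hi => hf.2 i (hi.trans k.le_succ)⟩ hu, add_right_comm, add_assoc]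

/-! ### Completeness of the Hermite polynomials -/

lemma memLp_exp_abs (t : ℝ) : MemLp (fun x : ℝ => Real.exp |t * x|) 2 rhoMeasure := by
  refine (memLp_two_iff_integrable_sq (by fun_prop)).2 ?_
  have h : ∀ s : ℝ, Integrable (fun x => Real.exp (s * x)) rhoMeasure := fun s => by
    rw [rhoMeasure_eq_gaussianReal]; exact integrable_exp_mul_gaussianReal s
  refine ((h (2 * t)).add (h (-(2 * t)))).mono' (by fun_prop) (Eventually.of_forall fun x => ?_)
  rw [← Real.exp_nat_mul, Real.norm_of_nonneg (Real.exp_pos _).le]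
  have h1 := Real.exp_pos (2 * t * x)
  have h2 := Real.exp_pos (-(2 * t) * x)
  simp only [Pi.add_apply]
  rcases abs_cases (t * x) with ⟨h3, -⟩ | ⟨h3, -⟩ <;> rw [h3]
  · rw [show ((2 : ℕ) : ℝ) * (t * x) = 2 * t * x by push_cast; ring]; linarith
  · rw [show ((2 : ℕ) : ℝ) * -(t * x) = -(2 * t) * x by push_cast; ring]; linarith

/-- If all moments of `f ρ` vanish, so does its Fourier transform: the exponential series may be
integrated term by term because `exp |t x|` is in `L²(ρ)`. -/
lemma integral_mul_cexp_eq_zero {f : ℝ → ℝ} (hf : MemLp f 2 rhoMeasure)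
    (h : ∀ n : ℕ, ∫ x, f x * x ^ n ∂rhoMeasure = 0) (t : ℝ) :
    ∫ x, (f x : ℂ) * Complex.exp (t * x * Complex.I) ∂rhoMeasure = 0 := by
  have hs := hasSum_integral_of_dominated_convergence (μ := rhoMeasure)
    (F := fun (n : ℕ) x => (f x : ℂ) * ((t * x * Complex.I) ^ n / n.factorial))
    (f := fun x => (f x : ℂ) * Complex.exp (t * x * Complex.I))
    (fun n x => |f x| * (|t * x| ^ n / n.factorial)) (fun n => ?_) (fun n => ?_) ?_ ?_ ?_
  · refine hs.unique ?_
    convert! hasSum_zero with n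
    have : ∀ x : ℝ, (f x : ℂ) * ((t * x * Complex.I) ^ n / n.factorial) =
        ((t * Complex.I) ^ n / n.factorial) * ((f x * x ^ n : ℝ) : ℂ) := fun x => by
      push_cast; ring
    simp_rw [this]
    rw [integral_const_mul, integral_complex_ofReal, h n]
    simp
  · exact (Complex.continuous_ofReal.comp_aestronglyMeasurable hf.1).mul
      (by fun_prop)
  · exact Eventually.of_forall fun x => by simp
  · exact Eventually.of_forall fun x => (Real.summable_pow_div_factorial _).mul_left _
  · simp_rw [tsum_mul_left]
    refine (hf.abs.integrable_mul (memLp_exp_abs t)).congr (Eventually.of_forall fun x => ?_)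
    simp [Real.exp_eq_exp_ℝ, NormedSpace.exp_eq_tsum_div]
  · refine Eventually.of_forall fun x => HasSum.mul_left _ ?_
    rw [Complex.exp_eq_exp_ℂ]
    exact NormedSpace.expSeries_div_hasSum_exp _

/-- Completeness of the monomials in `L²(ρ)`: the finite measures with densities `f⁺` and `f⁻`
have the same characteristic function. -/
lemma ae_eq_zero_of_integral_mul_pow_eq_zero {f : ℝ → ℝ} (hf : MemLp f 2 rhoMeasure)
    (h : ∀ n : ℕ, ∫ x, f x * x ^ n ∂rhoMeasure = 0) : f =ᵐ[rhoMeasure] 0 := by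
  have hfi : Integrable f rhoMeasure := hf.integrable (by norm_num)
  have hm := hfi.1.aemeasurable
  have := isFiniteMeasure_withDensity_ofReal hfi.2
  have := isFiniteMeasure_withDensity_ofReal hfi.neg.2
  have hexp (t : ℝ) {u : ℝ → ℝ} (hu : Integrable u rhoMeasure) :
      Integrable (fun x => (u x : ℂ) * Complex.exp (t * x * Complex.I)) rhoMeasure := by
    refine hu.ofReal.mul_of_top_left ?_
    refine memLp_top_of_bound (by fun_prop) 1 (Eventually.of_forall fun x => ?_)
    rw [← Complex.ofReal_mul, Complex.norm_exp_ofReal_mul_I]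
  have hchar : rhoMeasure.withDensity (fun x => ENNReal.ofReal (f x)) =
      rhoMeasure.withDensity fun x => ENNReal.ofReal ((-f) x) := by
    refine Measure.ext_of_charFun ?_
    ext t
    rw [charFun_apply_real, charFun_apply_real,
      integral_withDensity_eq_integral_toReal_smul₀ hm.ennreal_ofReal (by simp),
      integral_withDensity_eq_integral_toReal_smul₀ hm.neg.ennreal_ofReal (by simp), ← sub_eq_zero]
    simp only [Complex.real_smul]
    rw [← integral_sub, ← integral_mul_cexp_eq_zero hf h t]
    · congr with x
      rw [← sub_mul, ← Complex.ofReal_sub, ENNReal.toReal_ofReal', ENNReal.toReal_ofReal']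
      congr 2
      simp
    · simpa only [ENNReal.toReal_ofReal'] using hexp t hfi.pos_part
    · simpa only [ENNReal.toReal_ofReal'] using hexp t hfi.neg.pos_part
  rw [withDensity_eq_iff hm.ennreal_ofReal hm.neg.ennreal_ofReal hfi.lintegral_lt_top.ne] at hchar
  filter_upwards [hchar] with x hx
  have := congrArg ENNReal.toReal hx
  rw [ENNReal.toReal_ofReal', ENNReal.toReal_ofReal'] at this
  simpa [this] using (max_zero_sub_eq_self (f x)).symm

lemma ae_eq_zero_of_integral_mul_hermiteReal_eq_zero {f : ℝ → ℝ} (hf : MemLp f 2 rhoMeasure)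
    (h : ∀ n : ℕ, ∫ x, f x * (hermiteReal n).eval x ∂rhoMeasure = 0) : f =ᵐ[rhoMeasure] 0 := by
  refine ae_eq_zero_of_integral_mul_pow_eq_zero hf fun n => ?_
  have hX := eq_sum_hermiteReal (n + 1) (X ^ n) fun m hm => by
    simp [coeff_X_pow, show m ≠ n by omega]
  have hx : ∀ x : ℝ, f x * x ^ n = f x * (X ^ n : ℝ[X]).eval x := fun x => by simp
  simp_rw [hx]
  rw [hX]
  simp only [eval_finsetSum, eval_mul, eval_C, Finset.mul_sum, mul_left_comm (f _)]
  rw [integral_finsetSum _ fun j _ => (integrable_mul_eval hf _).const_mul _]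
  refine Finset.sum_eq_zero fun j _ => ?_
  rw [integral_const_mul, h j, mul_zero]

/-! ### Parseval's identity -/

/-- Parseval's identity for the Hermite expansion in `L²(ρ)`. -/
lemma hasSum_integral_mul_hermiteReal_sq {f : ℝ → ℝ} (hf : MemLp f 2 rhoMeasure) :
    HasSum (fun n : ℕ => (∫ x, f x * (hermiteReal n).eval x ∂rhoMeasure) ^ 2 / n.factorial)
      (l2Norm rhoMeasure f ^ 2) := by
  let e : ℕ → Lp ℝ 2 rhoMeasure := fun n =>
    (memLp_eval (C (Real.sqrt n.factorial)⁻¹ * hermiteReal n)).toLp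
  have he : ∀ n {u : ℝ → ℝ} (hu : MemLp u 2 rhoMeasure), inner ℝ (e n) hu.toLp =
      (Real.sqrt n.factorial)⁻¹ * ∫ x, u x * (hermiteReal n).eval x ∂rhoMeasure := by
    intro n u hu
    rw [L2.inner_def, ← integral_const_mul]
    refine integral_congr_ae ?_
    filter_upwards [hu.coeFn_toLp,
      (memLp_eval (C (Real.sqrt n.factorial)⁻¹ * hermiteReal n)).coeFn_toLp] with x h1 h2
    simp only [e, h1, h2]
    simp; ring
  have hon : Orthonormal ℝ e := by
    rw [orthonormal_iff_ite]
    intro m n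
    rw [he m (memLp_eval _)]
    simp only [eval_mul, eval_C, mul_assoc]
    rw [integral_const_mul, integral_hermiteReal_mul_hermiteReal]
    rcases eq_or_ne m n with rfl | hmn
    · have h0 : (m.factorial : ℝ) ≠ 0 := by positivity
      rw [if_pos rfl, if_pos rfl, ← mul_assoc, ← mul_inv,
        Real.mul_self_sqrt (by positivity), inv_mul_cancel₀ h0]
    · simp [hmn, hmn.symm]
  -- A vector orthogonal to every `e n` has vanishing Hermite coefficients, so it is `0`.
  have hbot : (Submodule.span ℝ (Set.range e))ᗮ = ⊥ := by
    rw [Submodule.eq_bot_iff]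
    intro u hu
    have hu2 := Lp.memLp u
    have h0 := ae_eq_zero_of_integral_mul_hermiteReal_eq_zero hu2 fun n => by
      have h1 := (Submodule.mem_orthogonal _ _).1 hu (e n)
        (Submodule.subset_span (Set.mem_range_self n))
      rw [← Lp.toLp_coeFn u hu2, he n hu2] at h1
      exact (mul_eq_zero.1 h1).resolve_left (by positivity)
    exact (Lp.eq_zero_iff_ae_eq_zero).2 h0
  let b := HilbertBasis.mkOfOrthogonalEqBot hon hbot
  have hb := b.hasSum_inner_mul_inner hf.toLp hf.toLp
  rw [real_inner_self_eq_norm_sq, Lp.norm_toLp] at hb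
  convert! hb using 2 with n
  rw [real_inner_comm, HilbertBasis.coe_mkOfOrthogonalEqBot, he n hf, ← pow_two, mul_pow, inv_pow,
    Real.sq_sqrt (by positivity), div_eq_inv_mul]

/-! ### The projection error -/

lemma proj_rhoMeasure (N : ℕ) (f : ℝ → ℝ) (x : ℝ) :
    proj rhoMeasure N f x = (∑ n ∈ Finset.range (N + 1),
      C ((∫ y, f y * (hermiteReal n).eval y ∂rhoMeasure) / n.factorial) * hermiteReal n).eval x := by
  rw [proj, eval_finsetSum]
  refine Finset.sum_congr rfl fun n _ => ?_
  simp_rw [orthonormalPoly_rhoMeasure, mul_div_assoc']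
  rw [integral_div, eval_mul, eval_C, div_mul_eq_mul_div, div_div,
    Real.mul_self_sqrt (by positivity), div_mul_eq_mul_div]

lemma memLp_sub_proj {f : ℝ → ℝ} (hf : MemLp f 2 rhoMeasure) (N : ℕ) :
    MemLp (fun x => f x - proj rhoMeasure N f x) 2 rhoMeasure := by
  simp_rw [proj_rhoMeasure]
  exact hf.sub (memLp_eval _)

lemma integral_sub_proj_mul_hermiteReal {f : ℝ → ℝ} (hf : MemLp f 2 rhoMeasure) (N n : ℕ) :
    ∫ x, (f x - proj rhoMeasure N f x) * (hermiteReal n).eval x ∂rhoMeasure =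
      if n ≤ N then 0 else ∫ x, f x * (hermiteReal n).eval x ∂rhoMeasure := by
  simp_rw [proj_rhoMeasure, sub_mul]
  rw [integral_sub (integrable_mul_eval hf _) (integrable_eval_mul_eval _ _)]
  simp only [eval_finsetSum, eval_mul, eval_C, Finset.sum_mul, mul_assoc]
  rw [integral_finsetSum _ fun j _ => (integrable_eval_mul_eval _ _).const_mul _]
  simp only [integral_const_mul, integral_hermiteReal_mul_hermiteReal]
  have hn : (n.factorial : ℝ) ≠ 0 := by positivity
  split_ifs with h
  · rw [Finset.sum_eq_single_of_mem n (Finset.mem_range.2 (by omega))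
      fun m _ hm => by rw [if_neg hm, mul_zero], if_pos rfl, div_mul_cancel₀ _ hn, sub_self]
  · rw [Finset.sum_eq_zero fun m hm => ?_, sub_zero]
    rw [if_neg (by have := Finset.mem_range.1 hm; omega), mul_zero]

/-- Each of the `k` factors of the falling factorial is at least `n + 1 - k ≥ n / k`. -/
lemma pow_le_pow_mul_descFactorial {k n : ℕ} (h : k ≤ n) :
    n ^ k ≤ k ^ k * n.descFactorial k := by
  rcases k.eq_zero_or_pos with rfl | hk
  · simp
  refine le_trans ?_ (Nat.mul_le_mul_left _ (n.pow_sub_le_descFactorial k))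
  rw [← mul_pow]
  refine Nat.pow_le_pow_left ?_ k
  obtain ⟨m, rfl⟩ := Nat.exists_eq_add_of_le h
  rw [show k + m + 1 - k = m + 1 by omega]
  nlinarith

/-- The coefficient of `f` of order `n` has square at most `k ^ k / n ^ k` times the square of the
coefficient of order `n - k` of `f^(k)`. For `n < k`, where there is no such coefficient, `N < k`
makes the constant `k ^ k / N ^ k` at least `1`. -/
lemma l2Norm_sub_proj_sq_le {k N : ℕ} (hN : 1 ≤ N) {f g : ℝ → ℝ}
    (hf : MemSobolev rhoMeasure k f) (hg : HasWeakDeriv k f g) (hg2 : MemLp g 2 rhoMeasure) :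
    l2Norm rhoMeasure (fun x => f x - proj rhoMeasure N f x) ^ 2 ≤
      (k : ℝ) ^ k / (N : ℝ) ^ k * (l2Norm rhoMeasure f ^ 2 + l2Norm rhoMeasure g ^ 2) := by
  set a : ℕ → ℝ := fun n => ∫ x, f x * (hermiteReal n).eval x ∂rhoMeasure
  -- `c n` is the squared coefficient of order `n - k` of `g`, extended by `0` to `n < k`.
  set c : ℕ → ℝ := fun n => if k ≤ n then a n ^ 2 / (n - k).factorial else 0
  have hsf := hasSum_integral_mul_hermiteReal_sq hf.1
  have hsg : HasSum c (l2Norm rhoMeasure g ^ 2) := by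
    rw [← (add_left_injective k).hasSum_iff fun n hn => if_neg fun h => hn ⟨n - k, by simp [h]⟩]
    convert! hasSum_integral_mul_hermiteReal_sq hg2 using 2 with n
    simp [a, hf.integral_mul_hermiteReal hg]
  refine hasSum_le (fun n => ?_) (hasSum_integral_mul_hermiteReal_sq (memLp_sub_proj hf.1 N))
    ((hsf.add hsg).mul_left _)
  rw [integral_sub_proj_mul_hermiteReal hf.1]
  have hc : 0 ≤ c n := by simp only [c]; split_ifs <;> positivity
  have ha : 0 ≤ a n ^ 2 / n.factorial := by positivity
  have hN0 : (0 : ℝ) < (N : ℝ) ^ k := by positivity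
  change _ ≤ (k : ℝ) ^ k / (N : ℝ) ^ k * (a n ^ 2 / n.factorial + c n)
  split_ifs with hnN
  · rw [zero_pow two_ne_zero, zero_div]; positivity
  change a n ^ 2 / n.factorial ≤ _
  rw [div_mul_eq_mul_div, le_div_iff₀ hN0]
  push Not at hnN
  rcases le_or_gt k n with hkn | hkn
  · have h1 : (N : ℝ) ^ k ≤ (k : ℝ) ^ k * n.descFactorial k := by
      refine le_trans (pow_le_pow_left₀ N.cast_nonneg (Nat.cast_le.2 hnN.le) k) ?_
      exact_mod_cast pow_le_pow_mul_descFactorial hkn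
    have h2 : ((n - k).factorial : ℝ) * n.descFactorial k = n.factorial := by
      exact_mod_cast Nat.factorial_mul_descFactorial hkn
    have h3 : c n = a n ^ 2 / n.factorial * n.descFactorial k := by
      have hd : (n.descFactorial k : ℝ) ≠ 0 := by
        exact_mod_cast (Nat.descFactorial_eq_zero_iff_lt.not.2 hkn.not_gt)
      have hnk : ((n - k).factorial : ℝ) ≠ 0 := by positivity
      simp only [c, if_pos hkn]
      rw [← h2]
      field_simp
    calc a n ^ 2 / n.factorial * (N : ℝ) ^ k
        ≤ a n ^ 2 / n.factorial * ((k : ℝ) ^ k * n.descFactorial k) :=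
          mul_le_mul_of_nonneg_left h1 ha
      _ = (k : ℝ) ^ k * c n := by rw [h3]; ring
      _ ≤ (k : ℝ) ^ k * (a n ^ 2 / n.factorial + c n) :=
          mul_le_mul_of_nonneg_left (by linarith) (by positivity)
  · have h1 : (N : ℝ) ^ k ≤ (k : ℝ) ^ k :=
      pow_le_pow_left₀ N.cast_nonneg (Nat.cast_le.2 (hnN.trans hkn).le) k
    calc a n ^ 2 / n.factorial * (N : ℝ) ^ k
        ≤ a n ^ 2 / n.factorial * (k : ℝ) ^ k := mul_le_mul_of_nonneg_left h1 ha
      _ = (k : ℝ) ^ k * (a n ^ 2 / n.factorial) := mul_comm _ _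
      _ ≤ (k : ℝ) ^ k * (a n ^ 2 / n.factorial + c n) :=
          mul_le_mul_of_nonneg_left (by linarith) (by positivity)

/-- Weak derivatives are unique almost everywhere, so the chosen one is in `L²(ρ)` as soon as some
representative is. -/
lemma MemSobolev.weakDeriv_spec {k i : ℕ} {f : ℝ → ℝ} (hf : MemSobolev rhoMeasure k f)
    (hi : i ≤ k) :
    HasWeakDeriv i f (weakDeriv i f) ∧ MemLp (weakDeriv i f) 2 rhoMeasure := by
  obtain ⟨g, hg, hg2⟩ := hf.2 i hi
  have h : ∃ g, HasWeakDeriv i f g := ⟨g, hg⟩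
  have hw : HasWeakDeriv i f (weakDeriv i f) := by
    rw [weakDeriv, dif_pos h]; exact h.choose_spec
  exact ⟨hw, hg2.ae_eq (rhoMeasure_absolutelyContinuous.ae_le (hg.ae_eq hw))⟩

lemma MemSobolev.l2Norm_sq_add_le {k : ℕ} (hk : 1 ≤ k) {f : ℝ → ℝ}
    (hf : MemSobolev rhoMeasure k f) :
    l2Norm rhoMeasure f ^ 2 + l2Norm rhoMeasure (weakDeriv k f) ^ 2 ≤
      sobolevNorm rhoMeasure k f ^ 2 := by
  have h0 : l2Norm rhoMeasure (weakDeriv 0 f) = l2Norm rhoMeasure f :=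
    congrArg ENNReal.toReal (eLpNorm_congr_ae
      (rhoMeasure_absolutelyContinuous.ae_le (hf.weakDeriv_spec k.zero_le).1.ae_eq_self))
  rw [sobolevNorm, Real.sq_sqrt (Finset.sum_nonneg fun _ _ => sq_nonneg _), ← h0,
    Finset.sum_range_succ]
  gcongr
  exact Finset.single_le_sum (f := fun i => l2Norm rhoMeasure (weakDeriv i f) ^ 2)
    (fun _ _ => sq_nonneg _) (Finset.mem_range.2 hk)

end WeightedApprox

theorem proposition3p2 (k : ℕ) (hk : 1 ≤ k) :
    ∃ Λ : ℝ, 0 < Λ ∧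
      ∀ f : ℝ → ℝ, WeightedApprox.MemSobolev WeightedApprox.rhoMeasure k f →
        ∀ N : ℕ, 1 ≤ N →
          MemLp (fun x => f x - WeightedApprox.proj WeightedApprox.rhoMeasure N f x) 2
            WeightedApprox.rhoMeasure ∧
          WeightedApprox.l2Norm WeightedApprox.rhoMeasure
              (fun x => f x - WeightedApprox.proj WeightedApprox.rhoMeasure N f x)
            ≤ Λ * WeightedApprox.sobolevNorm WeightedApprox.rhoMeasure k f *
              (1 / (N : ℝ) ^ ((k : ℝ) / 2)) := by
  refine ⟨Real.sqrt ((k : ℝ) ^ k), by positivity, fun f hf N hN =>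
    ⟨WeightedApprox.memLp_sub_proj hf.1 N, ?_⟩⟩
  obtain ⟨hg, hg2⟩ := hf.weakDeriv_spec le_rfl
  have hS : 0 ≤ WeightedApprox.sobolevNorm WeightedApprox.rhoMeasure k f := Real.sqrt_nonneg _
  refine le_of_sq_le_sq ?_ (by positivity)
  refine (WeightedApprox.l2Norm_sub_proj_sq_le hN hf hg hg2).trans ?_
  refine (mul_le_mul_of_nonneg_left (hf.l2Norm_sq_add_le hk) (by positivity)).trans_eq ?_
  rw [mul_pow, mul_pow, Real.sq_sqrt (by positivity), div_pow, ← Real.rpow_mul_natCast N.cast_nonneg,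
    Nat.cast_two, div_mul_cancel₀ _ two_ne_zero, Real.rpow_natCast]
  ring
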